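/- A binary word of length $n$ is $w=(w_1,\dots,w_n)\in\{0,1\}^n$. For $u\in\{0,1\}^\ell$ and $w\in\{0,1\}^n$ let $t(u,w)$ be the number of index sets $\{i_1<\dots<i_\ell\}\subseteq\{1,\dots,n\}$ with $(w_{i_1},\dots,w_{i_\ell})=u$, divided by $\binom n\ell$. For a Lebesgue measurable $f:[0,1]\to[0,1]$ write $f^1=f$, $f^0=1-f$ and $$t(u,f)=\ell!\int_{0\le x_1<\dots<x_\ell\le 1}\ \prod_{i=1}^{\ell} f^{u_i}(x_i)\,dx_1\cdots dx_\ell .$$ Let $(w_n)$ be a sequence of binary words whose lengths tend to infinity. It is called convergent if $(t(u,w_n))_n$ converges for every finite word $u$, and it converges to $f$ if $t(u,w_n)\to t(u,f)$ for every finite word $u$. Theorem. (i) For each convergent word sequence $(w_n)$ there is a Lebesgue measurable $f:[0,1]\to[0,1]$ such that $(w_n)$ converges to $f$; moreover, if $(w_n)$ also converges to a Lebesgue measurable $g:[0,1]\to[0,1]$, then $f=g$ almost everywhere. (ii) Conversely, for every Lebesgue measurable $f:[0,1]\to[0,1]$ there is a word sequence $(w_n)$, with $w_n\in\{0,1\}^n$,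 which converges to $f$. (iii) In fact, the $f$-random words converge to $f$ almost surely. Here the $n$-th $f$-random word is obtained from $n$ independent pairs $(X_1,Y_1),\dots,(X_n,Y_n)$, where $X_i$ is uniform on $[0,1]$ and, given $X_i=x$, $Y_i\in\{0,1\}$ equals $1$ with probability $f(x)$, by reading the letters $Y_i$ in increasing order of the $X_i$; the words for different $n$ are defined on one probability space, with an arbitrary joint distribution. -/

import Mathlib

open MeasureTheory ProbabilityTheory Filter
open scoped Topology unitInterval

noncomputable section

namespace WordLimits

/-- Binary words of length `n`; the letter `1` is `true` and the letter `0` is `false`. -/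
abbrev Word (n : ℕ) : Type := Fin n → Bool

/-- The number of index sets `i_1 < ... < i_ℓ` at which `w` reads the word `u`. An index set of
size `ℓ` is given by its strictly increasing enumeration. -/
def occurrences {ℓ n : ℕ} (u : Word ℓ) (w : Word n) : ℕ :=
  Nat.card {e : Fin ℓ → Fin n // StrictMono e ∧ ∀ j, w (e j) = u j}

/-- The subsequence density `t(u, w)`: the proportion of the `ℓ`-subsets of `[n]` at which `w`
reads `u`. -/
def density {ℓ n : ℕ} (u : Word ℓ) (w : Word n) : ℝ :=
  (occurrences u w : ℝ) / (n.choose ℓ : ℝ)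

/-- `f¹ = f` and `f⁰ = 1 - f`. -/
def letterFun (f : I → I) (b : Bool) (x : I) : ℝ :=
  if b then (f x : ℝ) else 1 - (f x : ℝ)

/-- The subsequence density `t(u, f)`: `ℓ!` times the integral of `∏ i, f^{u_i}(x_i)` over the
simplex `x_1 < ... < x_ℓ` in `[0,1]^ℓ`, with respect to Lebesgue measure. -/
def limitDensity {ℓ : ℕ} (u : Word ℓ) (f : I → I) : ℝ :=
  (ℓ.factorial : ℝ) * ∫ x in {x : Fin ℓ → I | StrictMono x}, ∏ i, letterFun f (u i) (x i)

/-- A sequence of words is convergent if all its subsequence densities converge. -/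
def IsConvergent {len : ℕ → ℕ} (w : (k : ℕ) → Word (len k)) : Prop :=
  ∀ (ℓ : ℕ) (u : Word ℓ), ∃ a : ℝ, Tendsto (fun k => density u (w k)) atTop (𝓝 a)

/-- A sequence of words converges to `f` if all its subsequence densities converge to those
of `f`. -/
def ConvergesTo {len : ℕ → ℕ} (w : (k : ℕ) → Word (len k)) (f : I → I) : Prop :=
  ∀ (ℓ : ℕ) (u : Word ℓ), Tendsto (fun k => density u (w k)) atTop (𝓝 (limitDensity u f))

/-- The law of an `f`-random letter `(X, Y)`: `X` is uniform on `[0,1]` and, given `X = x`, the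
letter `Y` is `1` with probability `f x`. That is, `P(X ∈ A, Y = b) = ∫_A f^b`. -/
def letterLaw (f : I → I) : Measure (I × Bool) :=
  (volume.withDensity fun x => ENNReal.ofReal (letterFun f true x)).map (fun x => (x, true)) +
  (volume.withDensity fun x => ENNReal.ofReal (letterFun f false x)).map (fun x => (x, false))

/-- The word obtained from the pairs `(x_1, y_1), ..., (x_n, y_n)` by reading the letters `y_i`
in increasing order of the positions `x_i`. -/
def readInOrder {n : ℕ} (z : Fin n → I × Bool) : Word n :=
  fun i => (z (Tuple.sort (fun j => (z j).1) i)).2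

end WordLimits

end

/-!
Put each letter of a word `w` of length `n` at a position in `[0,1]`, and let `empirical z` be the
uniform probability measure on the resulting points `z` of `[0,1] × {0,1}`. If the positions are
distinct, then `t(u, w)` is, up to the factor `n ^ ℓ / n.choose ℓ → ℓ!`, the mass that the `ℓ`-fold
product of this empirical measure gives to the open set `readingSet u` of tuples whose positions
increase and whose letters spell `u` (`density_readInOrder`). In the same way, `t(u, f)` is `ℓ!`
times the mass of `readingSet u` under the `ℓ`-fold product of the law `letterLaw f` of an
`f`-random letter (`pi_letterLaw_readingSet`). The boundary of `readingSet u` consists of tuples with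
two equal positions, which have mass zero under this product. Weak convergence passes to finite
products, so the portmanteau theorem shows that weak convergence of the empirical measures to
`letterLaw f` implies convergence of the words to `f` (`tendsto_density_of_tendsto_empirical`).

* Existence of a limit: place the letters of `w` at `0, 1/n, ..., (n-1)/n`. As the probability
  measures on `[0,1] × {0,1}` form a compact space, the empirical measures have a limit along some
  ultrafilter. Its first marginal is uniform (`map_fst_of_tendsto_gridLetters`), so by disintegration
  it is `letterLaw f` for some `f` (`exists_eq_letterLaw`). The densities converge by hypothesis, and
  hence they converge to their limits along the ultrafilter.
* Uniqueness: the sum of `t(v1, f)` over the words `v` of length `k` is `k + 1` times the `k`-th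
  moment of the measure with density `f` (`lintegral_letterFun_pow`), and by the Weierstrass theorem
  the moments determine that measure.
* Random words: by Hoeffding's inequality and the Borel-Cantelli lemma, the empirical averages of a
  bounded function converge almost surely, whatever the joint law for different `n`
  (`ae_tendsto_average`). Applied to a countable dense set of continuous functions this gives almost
  sure weak convergence of the empirical measures. Every `f` is thus the limit of some words.
-/

namespace WordLimits

open scoped ENNReal NNReal

/-! ### Empirical measures -/

/-- The empirical measure of a tuple `z`: the uniform distribution over its entries, counted with
multiplicity. For the empty tuple it is a Dirac mass at an arbitrary point, so that the empirical
measure is always a probability measure. -/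
noncomputable def empirical {α : Type*} [MeasurableSpace α] [Nonempty α] {n : ℕ}
    (z : Fin n → α) : ProbabilityMeasure α :=
  if h : 0 < n then
    ⟨(n : ℝ≥0∞)⁻¹ • ∑ i, Measure.dirac (z i), ⟨by
      simp [ENNReal.inv_mul_cancel (Nat.cast_ne_zero.2 h.ne') (ENNReal.natCast_ne_top n)]⟩⟩
  else ⟨Measure.dirac (Classical.arbitrary α), inferInstance⟩

section empirical

variable {α : Type*} [MeasurableSpace α] [Nonempty α] {n : ℕ}

lemma empirical_toMeasure (hn : 0 < n) (z : Fin n → α) :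
    (empirical z : Measure α) = (n : ℝ≥0∞)⁻¹ • ∑ i, Measure.dirac (z i) := by
  simp [empirical, hn]

lemma integral_empirical (hn : 0 < n) (z : Fin n → α) {φ : α → ℝ} (hφ : StronglyMeasurable φ) :
    ∫ x, φ x ∂(empirical z : Measure α) = (n : ℝ)⁻¹ * ∑ i, φ (z i) := by
  rw [empirical_toMeasure hn, integral_smul_measure, integral_finsetSum_measure]
  · simp [integral_dirac' _ _ hφ]
  · intro i _
    exact integrable_dirac' hφ (by simp)

lemma empirical_apply (hn : 0 < n) (z : Fin n → α) {s : Set α} (hs : MeasurableSet s) :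
    (empirical z : Measure α) s = (n : ℝ≥0∞)⁻¹ * ∑ i, s.indicator 1 (z i) := by
  simp [empirical_toMeasure hn, Measure.dirac_apply' _ hs]

/-- The product of empirical measures is the empirical measure of all `ℓ`-tuples of entries. -/
lemma pi_empirical_apply (hn : 0 < n) (z : Fin n → α) (ℓ : ℕ) {S : Set (Fin ℓ → α)}
    (hS : MeasurableSet S) :
    Measure.pi (fun _ : Fin ℓ => (empirical z : Measure α)) S =
      (Nat.card {e : Fin ℓ → Fin n // z ∘ e ∈ S} : ℝ≥0∞) / (n : ℝ≥0∞) ^ ℓ := by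
  classical
  have key : Measure.pi (fun _ : Fin ℓ => (empirical z : Measure α)) =
      ((n : ℝ≥0∞)⁻¹) ^ ℓ • ∑ e : Fin ℓ → Fin n, Measure.dirac (z ∘ e) := by
    refine Measure.pi_eq fun s hs => ?_
    simp only [empirical_apply hn z (hs _), Finset.prod_mul_distrib, Finset.prod_const,
      Finset.card_univ, Fintype.card_fin, Finset.prod_univ_sum, Measure.smul_apply,
      Measure.finsetSum_apply, smul_eq_mul, Fintype.piFinset_univ]
    congr 1
    refine Finset.sum_congr rfl fun e _ => ?_
    rw [Measure.dirac_apply' _ (MeasurableSet.univ_pi hs)]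
    by_cases h : ∀ j, z (e j) ∈ s j
    · simp [Set.indicator, Set.mem_pi, h]
    · have h' := h
      push Not at h'
      obtain ⟨j, hj⟩ := h'
      rw [Finset.prod_eq_zero (Finset.mem_univ j) (by simp [hj])]
      simp [Set.indicator, Set.mem_pi, h]
  rw [key]
  simp only [Measure.smul_apply, Measure.finsetSum_apply, Measure.dirac_apply' _ hS,
    Set.indicator, Pi.one_apply, smul_eq_mul]
  rw [Finset.sum_boole, Nat.card_eq_fintype_card, Fintype.card_subtype, ← ENNReal.inv_pow,
    ENNReal.div_eq_inv_mul]

end empirical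

/-! ### Subsequence densities as measures of a set of tuples -/

/-- The `ℓ`-tuples of placed letters whose positions are strictly increasing and whose letters spell
the word `u`. -/
def readingSet {ℓ : ℕ} (u : Word ℓ) : Set (Fin ℓ → I × Bool) :=
  {p | StrictMono (fun j => (p j).1) ∧ ∀ j, (p j).2 = u j}

lemma isOpen_strictMono (ℓ : ℕ) : IsOpen {x : Fin ℓ → I | StrictMono x} := by
  have : {x : Fin ℓ → I | StrictMono x} = ⋂ i, ⋂ j, {x | i < j → x i < x j} := by
    ext x; simp [StrictMono]
  rw [this]
  refine isOpen_iInter_of_finite fun i => isOpen_iInter_of_finite fun j => ?_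
  by_cases h : i < j
  · simpa [h] using isOpen_lt (continuous_apply i) (continuous_apply j)
  · simp [h]

lemma isOpen_readingSet {ℓ : ℕ} (u : Word ℓ) : IsOpen (readingSet u) := by
  have h : readingSet u = (fun p : Fin ℓ → I × Bool => fun j => (p j).1) ⁻¹' {x | StrictMono x} ∩
      ⋂ j, (fun p : Fin ℓ → I × Bool => (p j).2) ⁻¹' {u j} := by
    ext p; simp [readingSet]
  rw [h]
  refine ((isOpen_strictMono ℓ).preimage (by fun_prop)).inter
    (isOpen_iInter_of_finite fun j => (isOpen_discrete _).preimage (by fun_prop))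

/-- Letters vary in a discrete space, so the boundary of `readingSet u` has only ties of
positions. -/
lemma frontier_readingSet_subset {ℓ : ℕ} (u : Word ℓ) :
    frontier (readingSet u) ⊆ ⋃ i, ⋃ j, ⋃ (_ : i ≠ j), {p | (p i).1 = (p j).1} := by
  have hcl : closure (readingSet u) ⊆
      {p : Fin ℓ → I × Bool | (∀ i j, i < j → (p i).1 ≤ (p j).1) ∧ ∀ j, (p j).2 = u j} := by
    refine closure_minimal (fun p hp => ⟨fun i j h => (hp.1 h).le, hp.2⟩) ?_
    simp only [Set.ofPred_and, Set.ofPred_forall]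
    refine IsClosed.inter (isClosed_iInter fun i => isClosed_iInter fun j => isClosed_iInter
      fun _ => isClosed_le (by fun_prop) (by fun_prop))
      (isClosed_iInter fun j => isClosed_eq (by fun_prop) continuous_const)
  intro p hp
  rw [(isOpen_readingSet u).frontier_eq] at hp
  obtain ⟨h1, h2⟩ := hcl hp.1
  by_contra hne
  simp only [Set.mem_iUnion, not_exists, Set.mem_ofPred_eq] at hne
  exact hp.2 ⟨fun i j hij => lt_of_le_of_ne (h1 i j hij) (hne i j hij.ne), h2⟩

lemma strictMono_comp_sort {n : ℕ} {x : Fin n → I} (hx : Function.Injective x) :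
    StrictMono (x ∘ Tuple.sort x) :=
  (Tuple.monotone_sort x).strictMono_of_injective (hx.comp (Tuple.sort x).injective)

/-- Relabelling the indices in increasing order of position turns the tuples of entries of `z` that
spell `u` into the occurrences of `u` in the word read from `z`. -/
lemma card_readingSet {ℓ n : ℕ} (u : Word ℓ) {z : Fin n → I × Bool}
    (hz : Function.Injective fun i => (z i).1) :
    Nat.card {e : Fin ℓ → Fin n // z ∘ e ∈ readingSet u} = occurrences u (readInOrder z) := by
  set τ := Tuple.sort fun j => (z j).1
  have hτ : StrictMono fun i => (z (τ i)).1 := strictMono_comp_sort hz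
  refine Nat.card_congr ?_
  refine (Equiv.subtypeEquiv (Equiv.arrowCongr (Equiv.refl _) τ) fun e => ?_).symm
  simp only [readingSet, Set.mem_ofPred_eq, Equiv.arrowCongr_apply, Function.comp_apply,
    Equiv.refl_symm, Equiv.refl_apply, readInOrder]
  refine and_congr ⟨fun h => hτ.comp h, fun h i j hij => hτ.lt_iff_lt.1 (h hij)⟩ Iff.rfl

lemma density_readInOrder {ℓ n : ℕ} (hn : 0 < n) (u : Word ℓ) {z : Fin n → I × Bool}
    (hz : Function.Injective fun i => (z i).1) :
    density u (readInOrder z) =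
      (Measure.pi fun _ : Fin ℓ => (empirical z : Measure (I × Bool))).real (readingSet u) *
        ((n : ℝ) ^ ℓ / n.choose ℓ) := by
  rw [measureReal_def, pi_empirical_apply hn z ℓ (isOpen_readingSet u).measurableSet,
    card_readingSet u hz, density]
  have : (n : ℝ) ^ ℓ ≠ 0 := by positivity
  simp only [ENNReal.toReal_div, ENNReal.toReal_natCast, ENNReal.toReal_pow]
  field_simp

lemma tendsto_pow_div_choose (ℓ : ℕ) :
    Tendsto (fun n : ℕ => (n : ℝ) ^ ℓ / n.choose ℓ) atTop (𝓝 ℓ.factorial) := by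
  have h := (isEquivalent_choose ℓ)
  have h1 : ∀ᶠ n : ℕ in atTop, ((n : ℝ) ^ ℓ / ℓ.factorial) ≠ 0 := by
    filter_upwards [eventually_gt_atTop 0] with n hn
    positivity
  have h2 := (Asymptotics.isEquivalent_iff_tendsto_one h1).1 h
  have h3 := (h2.inv₀ one_ne_zero).const_mul (ℓ.factorial : ℝ)
  simp only [inv_one, mul_one] at h3
  refine h3.congr fun n => ?_
  have : (ℓ.factorial : ℝ) ≠ 0 := by positivity
  simp only [Pi.div_apply, inv_div]
  field_simp

/-! ### The law of an `f`-random letter -/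

lemma letterFun_nonneg (f : I → I) (b : Bool) (x : I) : 0 ≤ letterFun f b x := by
  cases b <;> simp [letterFun, (f x).2.1, (f x).2.2]

lemma letterFun_le_one (f : I → I) (b : Bool) (x : I) : letterFun f b x ≤ 1 := by
  cases b <;> simp [letterFun, (f x).2.1, (f x).2.2]

lemma letterFun_add (f : I → I) (x : I) : letterFun f true x + letterFun f false x = 1 := by
  simp [letterFun]

section

variable {f : I → I} (hf : NullMeasurable f volume)
include hf

lemma aemeasurable_letterFun (b : Bool) : AEMeasurable (letterFun f b) volume := by
  have h : AEMeasurable (fun x => (f x : ℝ)) volume :=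
    measurable_subtype_coe.comp_aemeasurable hf.aemeasurable
  cases b
  · simpa [letterFun] using! h.const_sub 1
  · simpa [letterFun] using! h

lemma letterLaw_map_fst : (letterLaw f).map Prod.fst = volume := by
  rw [letterLaw, Measure.map_add _ _ measurable_fst, Measure.map_map measurable_fst (by fun_prop),
    Measure.map_map measurable_fst (by fun_prop)]
  have h : ∀ b : Bool, (Prod.fst ∘ fun x : I => (x, b)) = id := fun b => rfl
  rw [h, h, Measure.map_id, Measure.map_id]
  ext s hs
  rw [Measure.add_apply, withDensity_apply _ hs, withDensity_apply _ hs,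
    ← lintegral_add_left' (aemeasurable_letterFun hf _).ennreal_ofReal.restrict]
  simp [← ENNReal.ofReal_add, letterFun_nonneg, letterFun_add]

lemma isProbabilityMeasure_letterLaw : IsProbabilityMeasure (letterLaw f) :=
  (Measure.isProbabilityMeasure_map_iff (μ := letterLaw f) measurable_fst.aemeasurable).1
    (by rw [letterLaw_map_fst hf]; infer_instance)

end

/-- On the event that the letter is `b`, the law of an `f`-random letter has density `f^b`. -/
lemma letterLaw_restrict (f : I → I) (b : Bool) :
    (letterLaw f).restrict {z | z.2 = b} =
      (volume.withDensity fun x => ENNReal.ofReal (letterFun f b x)).map (fun x => (x, b)) := by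
  have hs : MeasurableSet {z : I × Bool | z.2 = b} := measurable_snd (measurableSet_singleton b)
  have hm : ∀ c : Bool, Measurable fun x : I => (x, c) := fun c => by fun_prop
  rw [letterLaw, Measure.restrict_add, Measure.restrict_map (hm _) hs,
    Measure.restrict_map (hm _) hs]
  cases b <;> simp

lemma pi_withDensity_letterFun {f : I → I} (hf : NullMeasurable f volume) {ℓ : ℕ} (u : Word ℓ) :
    Measure.pi (fun j => (volume : Measure I).withDensity
        fun x => ENNReal.ofReal (letterFun f (u j) x)) =
      (volume : Measure (Fin ℓ → I)).withDensity
        fun x => ENNReal.ofReal (∏ j, letterFun f (u j) (x j)) := by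
  have hfin : ∀ j, IsFiniteMeasure ((volume : Measure I).withDensity
      fun x => ENNReal.ofReal (letterFun f (u j) x)) := fun j =>
    isFiniteMeasure_withDensity_ofReal
      (Integrable.of_bound (C := 1) (aemeasurable_letterFun hf _).aestronglyMeasurable
        (ae_of_all _ fun x => by
          rw [Real.norm_of_nonneg (letterFun_nonneg ..)]; exact letterFun_le_one ..)).2
  have hint : ∀ j (s : Set I), Integrable (letterFun f (u j)) (volume.restrict s) := fun j s =>
    Integrable.of_bound (C := 1) (aemeasurable_letterFun hf _).aestronglyMeasurable.restrict
        (ae_of_all _ fun x => by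
          rw [Real.norm_of_nonneg (letterFun_nonneg ..)]; exact letterFun_le_one ..)
  refine Measure.pi_eq fun s hs => ?_
  rw [withDensity_apply _ (MeasurableSet.univ_pi hs), volume_pi, Measure.restrict_pi_pi,
    ← ofReal_integral_eq_lintegral_ofReal (Integrable.fintype_prod fun j => hint j _)
      (ae_of_all _ fun x => Finset.prod_nonneg fun j _ => letterFun_nonneg ..),
    integral_fintype_prod_eq_prod, ENNReal.ofReal_prod_of_nonneg
      fun j _ => integral_nonneg fun x => letterFun_nonneg ..]
  refine Finset.prod_congr rfl fun j _ => ?_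
  rw [withDensity_apply _ (hs j), ofReal_integral_eq_lintegral_ofReal (hint j _)
      (ae_of_all _ fun x => letterFun_nonneg ..)]

/-- The density `t(u, f)` is the chance that `ℓ` independent `f`-random letters, read in order of
position, spell `u`. -/
lemma pi_letterLaw_readingSet {f : I → I} (hf : NullMeasurable f volume) {ℓ : ℕ} (u : Word ℓ) :
    (ℓ.factorial : ℝ) * (Measure.pi fun _ : Fin ℓ => letterLaw f).real (readingSet u) =
      limitDensity u f := by
  have := isProbabilityMeasure_letterLaw hf
  have hsplit : readingSet u = {p | StrictMono fun j => (p j).1} ∩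
      Set.univ.pi fun j => {z : I × Bool | z.2 = u j} := by
    ext p; simp [readingSet]
  have hT : Measurable fun (x : Fin ℓ → I) (j : Fin ℓ) => (x j, u j) := by fun_prop
  have hS : MeasurableSet {p : Fin ℓ → I × Bool | StrictMono fun j => (p j).1} :=
    (isOpen_strictMono ℓ).measurableSet.preimage
      (f := fun (p : Fin ℓ → I × Bool) j => (p j).1) (by fun_prop)
  have hfin : ∀ j, SigmaFinite (((volume : Measure I).withDensity
      fun x => ENNReal.ofReal (letterFun f (u j) x)).map fun x => (x, u j)) := fun j => by
    rw [← letterLaw_restrict]; infer_instance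
  have hmeas : (Measure.pi fun _ : Fin ℓ => letterLaw f) (readingSet u) =
      ∫⁻ x in {x : Fin ℓ → I | StrictMono x},
        ENNReal.ofReal (∏ j, letterFun f (u j) (x j)) := by
    rw [hsplit, ← Measure.restrict_apply hS, Measure.restrict_pi_pi]
    simp only [letterLaw_restrict]
    rw [← Measure.pi_map_pi fun j => by fun_prop, pi_withDensity_letterFun hf, Measure.map_apply hT hS,
      withDensity_apply _ (hT hS)]
    rfl
  rw [limitDensity, measureReal_def, hmeas, integral_eq_lintegral_of_nonneg_ae]
  · exact ae_of_all _ fun x => Finset.prod_nonneg fun j _ => letterFun_nonneg ..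
  · refine AEStronglyMeasurable.restrict (AEMeasurable.aestronglyMeasurable ?_)
    exact Finset.aemeasurable_fun_prod _ fun j _ =>
      (aemeasurable_letterFun hf (u j)).comp_quasiMeasurePreserving
        (Measure.quasiMeasurePreserving_eval (fun _ : Fin ℓ => (volume : Measure I)) j)

/-! ### Ties of positions and weak convergence -/

lemma ae_ne_of_indepFun {Ω : Type*} [MeasurableSpace Ω] {P : Measure Ω} [IsFiniteMeasure P]
    {X Y : Ω → I} (hX : AEMeasurable X P) (hY : AEMeasurable Y P) (hXY : IndepFun X Y P)
    (hlaw : P.map Y = volume) : ∀ᵐ ω ∂P, X ω ≠ Y ω := by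
  have h := (indepFun_iff_map_prod_eq_prod_map_map hX hY).1 hXY
  have hd : MeasurableSet {p : I × I | p.1 = p.2} := measurableSet_eq_fun measurable_fst measurable_snd
  have h0 : (P.map X).prod (P.map Y) {p : I × I | p.1 = p.2} = 0 := by
    rw [Measure.measure_prod_null hd, hlaw]
    refine ae_of_all _ fun x => ?_
    have : Prod.mk x ⁻¹' {p : I × I | p.1 = p.2} = {x} := by ext y; simp [eq_comm]
    simp [this]
  rw [← h, Measure.map_apply_of_aemeasurable (hX.prodMk hY) hd] at h0
  rw [ae_iff]
  simpa using! h0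

lemma ae_injective_of_iIndepFun {Ω : Type*} [MeasurableSpace Ω] {P : Measure Ω}
    [IsProbabilityMeasure P] {f : I → I} (hf : NullMeasurable f volume) {n : ℕ}
    {Z : Fin n → Ω → I × Bool} (hlaw : ∀ i, HasLaw (Z i) (letterLaw f) P) (hind : iIndepFun Z P) :
    ∀ᵐ ω ∂P, Function.Injective fun i => (Z i ω).1 := by
  have hm : ∀ i, AEMeasurable (fun ω => (Z i ω).1) P := fun i =>
    measurable_fst.comp_aemeasurable (hlaw i).aemeasurable
  have h : ∀ᵐ ω ∂P, ∀ i j, i ≠ j → (Z i ω).1 ≠ (Z j ω).1 := by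
    refine ae_all_iff.2 fun i => ae_all_iff.2 fun j => ?_
    by_cases hij : i = j
    · simp [hij]
    · simp only [ne_eq, hij, not_false_eq_true, forall_const]
      refine ae_ne_of_indepFun (hm i) (hm j)
        ((hind.indepFun hij).comp measurable_fst measurable_fst) ?_
      have := AEMeasurable.map_map_of_aemeasurable (μ := P) (f := Z j) (g := Prod.fst)
        measurable_fst.aemeasurable (hlaw j).aemeasurable
      rw [(hlaw j).map_eq, letterLaw_map_fst hf] at this
      exact this.symm
  filter_upwards [h] with ω hω i j hij
  by_contra hne
  exact hω i j hne hij

lemma pi_letterLaw_frontier_readingSet {f : I → I} (hf : NullMeasurable f volume) {ℓ : ℕ}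
    (u : Word ℓ) : (Measure.pi fun _ : Fin ℓ => letterLaw f) (frontier (readingSet u)) = 0 := by
  have := isProbabilityMeasure_letterLaw hf
  have h := ae_injective_of_iIndepFun (P := Measure.pi fun _ : Fin ℓ => letterLaw f)
    (Z := fun i p => p i) hf
    (fun i => (measurePreserving_eval (fun _ : Fin ℓ => letterLaw f) i).hasLaw)
    (iIndepFun_pi (X := fun _ => id) fun _ => aemeasurable_id)
  refine measure_mono_null (fun p hp => ?_) (ae_iff.1 h)
  obtain ⟨i, j, hij, hp⟩ := by simpa using frontier_readingSet_subset u hp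
  exact fun hinj => hij (hinj hp)

/-- Weak convergence of the empirical measures of placed letters to `letterLaw f` implies
convergence of all subsequence densities to those of `f`. The filter `L` is arbitrary, to allow
limits along an ultrafilter. -/
theorem tendsto_density_of_tendsto_empirical {f : I → I} (hf : NullMeasurable f volume)
    {ι : Type*} {L : Filter ι} {len : ι → ℕ} (hlen : Tendsto len L atTop)
    {z : (k : ι) → Fin (len k) → I × Bool} (hz : ∀ k, Function.Injective fun i => (z k i).1)
    {μ : ProbabilityMeasure (I × Bool)} (hμ : (μ : Measure (I × Bool)) = letterLaw f)
    (h : Tendsto (fun k => empirical (z k)) L (𝓝 μ)) {ℓ : ℕ} (u : Word ℓ) :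
    Tendsto (fun k => density u (readInOrder (z k))) L (𝓝 (limitDensity u f)) := by
  have h1 : Tendsto (fun k => ProbabilityMeasure.pi fun _ : Fin ℓ => empirical (z k)) L
      (𝓝 (ProbabilityMeasure.pi fun _ : Fin ℓ => μ)) :=
    (ProbabilityMeasure.continuous_pi.tendsto _).comp (tendsto_pi_nhds.2 fun _ => h)
  have h2 := ProbabilityMeasure.tendsto_measure_of_null_frontier_of_tendsto' h1
    (E := readingSet u) (by
      simpa [hμ] using pi_letterLaw_frontier_readingSet hf u)
  have h3 := (ENNReal.tendsto_toReal (measure_ne_top _ _)).comp h2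
  have h4 := h3.mul ((tendsto_pow_div_choose ℓ).comp hlen)
  rw [← pi_letterLaw_readingSet hf u, mul_comm, ← hμ]
  refine h4.congr' ?_
  filter_upwards [hlen.eventually_gt_atTop 0] with k hk
  rw [density_readInOrder hk u (hz k)]
  rfl

/-! ### Random words -/

lemma dist_integral_continuousMap_le {X : Type*} [TopologicalSpace X] [CompactSpace X]
    [MeasurableSpace X] [OpensMeasurableSpace X] (ρ : Measure X) [IsFiniteMeasure ρ]
    (φ ψ : C(X, ℝ)) : dist (∫ x, φ x ∂ρ) (∫ x, ψ x ∂ρ) ≤ ρ.real Set.univ * dist φ ψ := by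
  have hint : ∀ φ : C(X, ℝ), Integrable φ ρ := fun φ =>
    Integrable.of_bound (C := ‖φ‖) φ.continuous.measurable.aestronglyMeasurable
      (ae_of_all _ φ.norm_coe_le_norm)
  rw [dist_eq_norm, ← integral_sub (hint φ) (hint ψ), dist_eq_norm, mul_comm]
  exact norm_integral_le_of_norm_le_const (ae_of_all _ (φ - ψ).norm_coe_le_norm)

/-- On a compact space, weak convergence can be tested on a dense set of continuous functions. -/
lemma tendsto_of_dense {X : Type*} [TopologicalSpace X] [CompactSpace X] [MeasurableSpace X]
    [OpensMeasurableSpace X] {ι : Type*} {L : Filter ι} {ν : ι → ProbabilityMeasure X}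
    {μ : ProbabilityMeasure X} {D : Set C(X, ℝ)} (hD : Dense D)
    (h : ∀ φ ∈ D, Tendsto (fun k => ∫ x, φ x ∂(ν k : Measure X)) L
      (𝓝 (∫ x, φ x ∂(μ : Measure X)))) : Tendsto ν L (𝓝 μ) := by
  have hdist : ∀ (φ ψ : C(X, ℝ)) (ρ : ProbabilityMeasure X),
      dist (∫ x, φ x ∂(ρ : Measure X)) (∫ x, ψ x ∂(ρ : Measure X)) ≤ dist φ ψ := fun φ ψ ρ => by
    simpa using dist_integral_continuousMap_le (ρ : Measure X) φ ψ
  refine ProbabilityMeasure.tendsto_iff_forall_integral_tendsto.2 fun φ => ?_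
  rw [Metric.tendsto_nhds]
  intro ε hε
  obtain ⟨ψ, hψD, hψ⟩ := hD.exists_dist_lt φ.toContinuousMap (ε := ε / 3) (by positivity)
  filter_upwards [Metric.tendsto_nhds.1 (h ψ hψD) (ε / 3) (by positivity)] with k hk
  have h1 := hdist φ.toContinuousMap ψ (ν k)
  have h2 := hdist φ.toContinuousMap ψ μ
  rw [dist_comm] at h2
  calc dist (∫ x, φ x ∂(ν k : Measure X)) (∫ x, φ x ∂(μ : Measure X))
      ≤ _ + _ + _ := dist_triangle4 _ (∫ x, ψ x ∂(ν k : Measure X)) (∫ x, ψ x ∂(μ : Measure X)) _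
    _ < ε / 3 + ε / 3 + ε / 3 := by
      gcongr
      · exact h1.trans_lt hψ
      · exact h2.trans_lt hψ
    _ = ε := by ring

/-- A one-sided strong law for triangular arrays with independent rows. The bounds of Hoeffding's
inequality are summable in `n`, so no assumption relates different rows. -/
lemma ae_eventually_sum_lt {Ω : Type*} [MeasurableSpace Ω] {P : Measure Ω}
    [IsProbabilityMeasure P] {X : (n : ℕ) → Fin n → Ω → ℝ} {c : ℝ≥0}
    (hX : ∀ n i, HasSubgaussianMGF (X n i) c P) (hind : ∀ n, iIndepFun (X n) P)
    {ε : ℝ} (hε : 0 < ε) : ∀ᵐ ω ∂P, ∀ᶠ n : ℕ in atTop, ∑ i, X n i ω < n * ε := by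
  have hbound : ∀ n : ℕ, P {ω | n * ε ≤ ∑ i, X n i ω} ≤
      ENNReal.ofReal (Real.exp (-(ε ^ 2 / (2 * (c + 1))) * n)) := by
    intro n
    -- The parameter `c` is increased to `c + 1`, as division by `2 * c` is meaningless for `c = 0`.
    have h := HasSubgaussianMGF.measure_sum_ge_le_of_iIndepFun (hind n) (c := fun _ => c + 1)
      (s := Finset.univ) (fun i _ => ⟨(hX n i).integrable_exp_mul, fun t =>
        ((hX n i).mgf_le t).trans (by gcongr; simp)⟩) (ε := n * ε) (by positivity)
    rw [← ofReal_measureReal]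
    refine ENNReal.ofReal_le_ofReal (h.trans (Real.exp_le_exp.2 (le_of_eq ?_)))
    rcases Nat.eq_zero_or_pos n with rfl | hn
    · simp
    · have : (n : ℝ) ≠ 0 := by positivity
      have : (c : ℝ) + 1 ≠ 0 := by positivity
      simp only [Finset.sum_const, Finset.card_univ, Fintype.card_fin, nsmul_eq_mul, NNReal.coe_mul,
        NNReal.coe_natCast, NNReal.coe_add, NNReal.coe_one]
      field_simp
  have hsum : Summable fun n : ℕ => Real.exp (-(ε ^ 2 / (2 * (c + 1))) * n) := by
    have hpos : 0 < ε ^ 2 / (2 * ((c : ℝ) + 1)) := by positivity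
    simpa [mul_comm] using Real.summable_exp_nat_mul_iff.2 (neg_lt_zero.2 hpos)
  have htop : ∑' n : ℕ, P {ω | n * ε ≤ ∑ i, X n i ω} ≠ ∞ :=
    ne_top_of_le_ne_top (hsum.tsum_ofReal_ne_top) (ENNReal.tsum_le_tsum hbound)
  filter_upwards [ae_eventually_notMem htop] with ω hω
  filter_upwards [hω] with n hn
  simpa using hn

/-- The strong law for a bounded function of a triangular array with independent, identically
distributed rows, with an arbitrary joint law of different rows. -/
lemma ae_tendsto_average {Ω E : Type*} [MeasurableSpace Ω] [MeasurableSpace E] {P : Measure Ω}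
    [IsProbabilityMeasure P] {ν : Measure E} {Z : (n : ℕ) → Fin n → Ω → E}
    (hlaw : ∀ n i, HasLaw (Z n i) ν P) (hind : ∀ n, iIndepFun (Z n) P)
    {φ : E → ℝ} (hφ : Measurable φ) {C : ℝ} (hC : ∀ x, |φ x| ≤ C) :
    ∀ᵐ ω ∂P, Tendsto (fun n : ℕ => (n : ℝ)⁻¹ * ∑ i, φ (Z n i ω)) atTop (𝓝 (∫ x, φ x ∂ν)) := by
  set m := ∫ x, φ x ∂ν
  have hmean : ∀ n i, ∫ ω, φ (Z n i ω) ∂P = m := fun n i =>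
    (hlaw n i).integral_comp hφ.aestronglyMeasurable
  have hsub : ∀ n i, HasSubgaussianMGF (fun ω => φ (Z n i ω) - m) ((‖C - -C‖₊ / 2) ^ 2) P := by
    intro n i
    rw [← hmean n i]
    exact hasSubgaussianMGF_of_mem_Icc (hφ.comp_aemeasurable (hlaw n i).aemeasurable)
      (ae_of_all _ fun ω => abs_le.1 (hC _))
  have hup : ∀ᵐ ω ∂P, ∀ j : ℕ, ∀ᶠ n : ℕ in atTop,
      ∑ i, (φ (Z n i ω) - m) < n * (1 / (j + 1 : ℝ)) :=
    ae_all_iff.2 fun j => ae_eventually_sum_lt hsub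
      (fun n => (hind n).comp (fun _ x => φ x - m) fun _ => by fun_prop) (by positivity)
  have hlow : ∀ᵐ ω ∂P, ∀ j : ℕ, ∀ᶠ n : ℕ in atTop,
      ∑ i, -(φ (Z n i ω) - m) < n * (1 / (j + 1 : ℝ)) :=
    ae_all_iff.2 fun j => ae_eventually_sum_lt (fun n i => (hsub n i).neg)
      (fun n => (hind n).comp (fun _ x => -(φ x - m)) fun _ => by fun_prop) (by positivity)
  filter_upwards [hup, hlow] with ω h1 h2
  rw [Metric.tendsto_nhds]
  intro ε hε
  obtain ⟨j, hj⟩ := exists_nat_one_div_lt hε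
  filter_upwards [h1 j, h2 j, eventually_gt_atTop 0] with n hn1 hn2 hn
  have hn' : (0 : ℝ) < n := by exact_mod_cast hn
  rw [Finset.sum_neg_distrib] at hn2
  have hsum : (n : ℝ)⁻¹ * ∑ i, φ (Z n i ω) - m = (n : ℝ)⁻¹ * ∑ i, (φ (Z n i ω) - m) := by
    simp only [Finset.sum_sub_distrib, Finset.sum_const, Finset.card_univ, Fintype.card_fin,
      nsmul_eq_mul]
    field_simp
  rw [Real.dist_eq, hsum, abs_mul, abs_of_pos (inv_pos.2 hn'), inv_mul_lt_iff₀ hn']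
  calc |∑ i, (φ (Z n i ω) - m)| < n * (1 / (j + 1 : ℝ)) := abs_lt.2 ⟨by linarith, hn1⟩
    _ < n * ε := by gcongr

lemma ae_tendsto_empirical {Ω E : Type*} [MeasurableSpace Ω] [TopologicalSpace E] [CompactSpace E]
    [TopologicalSpace.MetrizableSpace E] [MeasurableSpace E] [BorelSpace E] [Nonempty E]
    {P : Measure Ω} [IsProbabilityMeasure P] (μ : ProbabilityMeasure E)
    {Z : (n : ℕ) → Fin n → Ω → E}
    (hlaw : ∀ n i, HasLaw (Z n i) (μ : Measure E) P) (hind : ∀ n, iIndepFun (Z n) P) :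
    ∀ᵐ ω ∂P, Tendsto (fun n => empirical fun i => Z n i ω) atTop (𝓝 μ) := by
  let := TopologicalSpace.metrizableSpaceMetric E
  obtain ⟨D, hDc, hD⟩ := TopologicalSpace.exists_countable_dense C(E, ℝ)
  have h : ∀ᵐ ω ∂P, ∀ φ ∈ D, Tendsto (fun n : ℕ => (n : ℝ)⁻¹ * ∑ i, φ (Z n i ω)) atTop
      (𝓝 (∫ x, φ x ∂(μ : Measure E))) :=
    (ae_ball_iff hDc).2 fun φ _ =>
      ae_tendsto_average hlaw hind φ.continuous.measurable φ.norm_coe_le_norm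
  filter_upwards [h] with ω hω
  refine tendsto_of_dense hD fun φ hφ => (hω φ hφ).congr' ?_
  filter_upwards [eventually_gt_atTop 0] with n hn
  exact (integral_empirical hn _ φ.continuous.stronglyMeasurable).symm

theorem ae_convergesTo_readInOrder {f : I → I} (hf : NullMeasurable f volume)
    {Ω : Type*} [MeasurableSpace Ω] {P : Measure Ω} [IsProbabilityMeasure P]
    {Z : (n : ℕ) → Fin n → Ω → I × Bool} (hlaw : ∀ n i, HasLaw (Z n i) (letterLaw f) P)
    (hind : ∀ n, iIndepFun (Z n) P) :
    ∀ᵐ ω ∂P, ConvergesTo (len := fun n => n) (fun n => readInOrder fun i => Z n i ω) f := by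
  let μ : ProbabilityMeasure (I × Bool) := ⟨letterLaw f, isProbabilityMeasure_letterLaw hf⟩
  have hinj : ∀ᵐ ω ∂P, ∀ n, Function.Injective fun i => (Z n i ω).1 :=
    ae_all_iff.2 fun n => ae_injective_of_iIndepFun hf (hlaw n) (hind n)
  filter_upwards [ae_tendsto_empirical μ hlaw hind, hinj] with ω h1 h2
  exact fun ℓ u => tendsto_density_of_tendsto_empirical hf tendsto_id h2 rfl h1 u

theorem exists_convergesTo {f : I → I} (hf : NullMeasurable f volume) :
    ∃ w : (n : ℕ) → Word n, ConvergesTo (len := fun n => n) w f := by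
  have := isProbabilityMeasure_letterLaw hf
  obtain ⟨Ω, _, P, X, -, hlaw, hind, hP⟩ := exists_iid ℕ (letterLaw f)
  obtain ⟨ω, hω⟩ := (ae_convergesTo_readInOrder hf (P := P) (Z := fun n i => X i)
    (fun n i => hlaw i) (fun n => hind.precomp Fin.val_injective)).exists
  exact ⟨_, hω⟩

/-! ### Existence of limits -/

/-- The letters of a word of length `n`, placed at the positions `0, 1/n, ..., (n-1)/n`. -/
noncomputable def gridLetters {n : ℕ} (w : Word n) (i : Fin n) : I × Bool :=
  (⟨(i : ℝ) / n, by positivity, div_le_one_of_le₀ (by exact_mod_cast i.2.le) (by positivity)⟩, w i)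

lemma strictMono_gridLetters {n : ℕ} (w : Word n) : StrictMono fun i => (gridLetters w i).1 := by
  intro i j hij
  have hn : (0 : ℝ) < n := by exact_mod_cast i.pos
  have : ((i : ℕ) : ℝ) < (j : ℕ) := by exact_mod_cast hij
  exact Subtype.mk_lt_mk.2 (by gcongr)

lemma readInOrder_gridLetters {n : ℕ} (w : Word n) : readInOrder (gridLetters w) = w := by
  ext i
  simp only [readInOrder]
  rw [Tuple.sort_eq_refl_iff_monotone.2 (strictMono_gridLetters w).monotone]
  rfl

lemma empirical_gridLetters_Iio_le {n : ℕ} (hn : 0 < n) (w : Word n) (x : I) :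
    (empirical (gridLetters w) : Measure (I × Bool)) (Prod.fst ⁻¹' Set.Iio x) ≤
      ENNReal.ofReal (x + (n : ℝ)⁻¹) := by
  classical
  have hn' : (0 : ℝ) < n := by exact_mod_cast hn
  rw [empirical_apply hn _ (measurable_fst measurableSet_Iio), ← ENNReal.ofReal_natCast,
    ← ENNReal.ofReal_inv_of_pos hn']
  simp only [Set.indicator, Pi.one_apply]
  rw [Finset.sum_boole]
  have hcard : (Finset.univ.filter fun i : Fin n => gridLetters w i ∈ Prod.fst ⁻¹' Set.Iio x).card ≤
      ⌈n * (x : ℝ)⌉₊ := by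
    rw [← Finset.card_range ⌈n * (x : ℝ)⌉₊]
    refine Finset.card_le_card_of_injOn Fin.val (fun i hi => ?_) Fin.val_injective.injOn
    have hi' : ((i : ℕ) : ℝ) / n < x := by simpa using! hi
    rw [div_lt_iff₀' hn'] at hi'
    simpa using Nat.lt_ceil.2 hi'
  rw [← ENNReal.ofReal_natCast, ← ENNReal.ofReal_mul (by positivity)]
  refine ENNReal.ofReal_le_ofReal ?_
  have h1 : ((Finset.univ.filter fun i : Fin n => gridLetters w i ∈
      Prod.fst ⁻¹' Set.Iio x).card : ℝ) ≤ n * x + 1 :=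
    (Nat.cast_le.2 hcard).trans (Nat.ceil_lt_add_one (mul_nonneg hn'.le x.2.1)).le
  rw [inv_mul_le_iff₀ hn']
  calc _ ≤ _ := h1
    _ = _ := by field_simp

lemma empirical_gridLetters_Ioi_le {n : ℕ} (hn : 0 < n) (w : Word n) (x : I) :
    (empirical (gridLetters w) : Measure (I × Bool)) (Prod.fst ⁻¹' Set.Ioi x) ≤
      ENNReal.ofReal (1 - x) := by
  classical
  have hn' : (0 : ℝ) < n := by exact_mod_cast hn
  rw [empirical_apply hn _ (measurable_fst measurableSet_Ioi), ← ENNReal.ofReal_natCast,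
    ← ENNReal.ofReal_inv_of_pos hn']
  simp only [Set.indicator, Pi.one_apply]
  rw [Finset.sum_boole]
  have hcard : (Finset.univ.filter fun i : Fin n => gridLetters w i ∈ Prod.fst ⁻¹' Set.Ioi x).card ≤
      n - (⌊n * (x : ℝ)⌋₊ + 1) := by
    rw [← Nat.card_Ico]
    refine Finset.card_le_card_of_injOn Fin.val (fun i hi => ?_) Fin.val_injective.injOn
    have hi' : (x : ℝ) < ((i : ℕ) : ℝ) / n := by simpa using! hi
    rw [lt_div_iff₀' hn'] at hi'
    have := (Nat.floor_lt (mul_nonneg hn'.le x.2.1)).2 hi'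
    simp only [Finset.coe_Ico, Set.mem_Ico]
    exact ⟨this, i.2⟩
  rw [← ENNReal.ofReal_natCast, ← ENNReal.ofReal_mul (by positivity)]
  refine ENNReal.ofReal_le_ofReal ?_
  rw [inv_mul_le_iff₀ hn']
  have hfl := Nat.lt_floor_add_one (n * (x : ℝ))
  refine (Nat.cast_le.2 hcard).trans ?_
  rcases le_total (⌊n * (x : ℝ)⌋₊ + 1) n with h | h
  · rw [Nat.cast_sub h]
    push_cast
    linarith
  · rw [Nat.sub_eq_zero_of_le h, Nat.cast_zero]
    exact mul_nonneg hn'.le (sub_nonneg.2 x.2.2)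

/-- A weak limit of empirical measures of letters placed on finer and finer grids has uniform first
marginal. -/
lemma map_fst_of_tendsto_gridLetters {ι : Type*} {L : Filter ι} [L.NeBot] {len : ι → ℕ}
    (hlen : Tendsto len L atTop) (w : (k : ι) → Word (len k)) {μ : ProbabilityMeasure (I × Bool)}
    (h : Tendsto (fun k => empirical (gridLetters (w k))) L (𝓝 μ)) :
    (μ : Measure (I × Bool)).map Prod.fst = volume := by
  have hprob : IsProbabilityMeasure ((μ : Measure (I × Bool)).map Prod.fst) :=
    Measure.isProbabilityMeasure_map measurable_fst.aemeasurable
  -- The portmanteau theorem bounds the limit from above on open intervals. The bounds on `Iio x` and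
  -- `Ioi x` together determine the mass of `Iic x`.
  have hIio : ∀ x : I, (μ : Measure (I × Bool)).map Prod.fst (Set.Iio x) ≤ ENNReal.ofReal x := by
    intro x
    rw [Measure.map_apply measurable_fst measurableSet_Iio]
    refine (ProbabilityMeasure.le_liminf_measure_open_of_tendsto h
      (isOpen_Iio.preimage continuous_fst)).trans ?_
    have hlim : Tendsto (fun k => ENNReal.ofReal (x + (len k : ℝ)⁻¹)) L
        (𝓝 (ENNReal.ofReal x)) := by
      refine ENNReal.tendsto_ofReal ?_
      simpa using (tendsto_inv_atTop_nhds_zero_nat (𝕜 := ℝ).comp hlen).const_add (x : ℝ)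
    rw [← hlim.liminf_eq]
    refine liminf_le_liminf ?_
    filter_upwards [hlen.eventually_gt_atTop 0] with k hk
    exact empirical_gridLetters_Iio_le hk (w k) x
  have hIoi : ∀ x : I, (μ : Measure (I × Bool)).map Prod.fst (Set.Ioi x) ≤
      ENNReal.ofReal (1 - x) := by
    intro x
    rw [Measure.map_apply measurable_fst measurableSet_Ioi]
    refine (ProbabilityMeasure.le_liminf_measure_open_of_tendsto h
      (isOpen_Ioi.preimage continuous_fst)).trans ?_
    rw [← (tendsto_const_nhds (x := ENNReal.ofReal (1 - x)) (f := L)).liminf_eq]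
    refine liminf_le_liminf ?_
    filter_upwards [hlen.eventually_gt_atTop 0] with k hk
    exact empirical_gridLetters_Ioi_le hk (w k) x
  refine Measure.ext_of_Iic _ _ fun x => ?_
  rw [unitInterval.volume_Iic]
  refine le_antisymm ?_ ?_
  · rcases eq_or_lt_of_le (show x ≤ 1 from x.2.2) with rfl | hx
    · simpa using prob_le_one
    · refine le_of_forall_gt fun b hb => ?_
      have hcont : Tendsto (fun y : I => ENNReal.ofReal y) (𝓝[>] x) (𝓝 (ENNReal.ofReal x)) :=
        (ENNReal.continuous_ofReal.comp continuous_subtype_val).continuousWithinAt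
      have : (𝓝[>] x).NeBot := nhdsGT_neBot_of_exists_gt ⟨1, hx⟩
      obtain ⟨y, hyb, hxy⟩ := ((hcont.eventually_lt_const hb).and self_mem_nhdsWithin).exists
      exact ((measure_mono (Set.Iic_subset_Iio.2 hxy)).trans (hIio y)).trans_lt hyb
  · have hc := hIoi x
    rw [← Set.compl_Iic, prob_compl_eq_one_sub measurableSet_Iic] at hc
    have h1 : (1 : ℝ≥0∞) = ENNReal.ofReal x + ENNReal.ofReal (1 - x) := by
      rw [← ENNReal.ofReal_add x.2.1 (sub_nonneg.2 x.2.2)]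
      simp
    rw [tsub_le_iff_right, h1, add_comm] at hc
    exact (ENNReal.add_le_add_iff_left ENNReal.ofReal_ne_top).1 hc

/-- A probability measure on `[0,1] × {0,1}` with uniform first marginal is the law of an `f`-random
letter: `f x` is the conditional probability of the letter `1` at the position `x`. -/
lemma exists_eq_letterLaw (μ : Measure (I × Bool)) [IsProbabilityMeasure μ]
    (hμ : μ.map Prod.fst = volume) : ∃ f : I → I, Measurable f ∧ μ = letterLaw f := by
  have hle : ∀ x, (μ.condKernel x).real {true} ∈ I := fun x => ⟨measureReal_nonneg, measureReal_le_one⟩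
  have hmeas : ∀ b : Bool, Measurable fun x => μ.condKernel x {b} := fun b =>
    Kernel.measurable_coe _ (measurableSet_singleton b)
  let f : I → I := fun x => ⟨(μ.condKernel x).real {true}, hle x⟩
  have hf : Measurable f := ((hmeas true).ennreal_toReal).subtype_mk
  have hlet : ∀ b x, ENNReal.ofReal (letterFun f b x) = μ.condKernel x {b} := by
    intro b x
    have htrue : letterFun f true x = (μ.condKernel x).real {true} := by simp [letterFun, f]
    have : letterFun f b x = (μ.condKernel x).real {b} := by
      cases b
      · have h := probReal_compl_eq_one_sub (μ := μ.condKernel x) (measurableSet_singleton true)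
        rw [show ({true}ᶜ : Set Bool) = {false} by ext b; cases b <;> simp, ← htrue] at h
        rw [h, ← letterFun_add f x]
        ring
      · exact htrue
    rw [this, ofReal_measureReal]
  refine ⟨f, hf, Measure.ext fun s hs => ?_⟩
  have hm : ∀ c : Bool, Measurable fun x : I => (x, c) := fun c => by fun_prop
  conv_lhs => rw [← μ.disintegrate μ.condKernel]
  rw [Measure.compProd_apply hs, Measure.fst, hμ, letterLaw, Measure.add_apply,
    Measure.map_apply (hm _) hs, Measure.map_apply (hm _) hs, withDensity_apply _ (hm _ hs),
    withDensity_apply _ (hm _ hs), ← lintegral_indicator (hm _ hs),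
    ← lintegral_indicator (hm _ hs)]
  simp only [hlet]
  rw [← lintegral_add_left ((hmeas true).indicator (hm _ hs))]
  refine lintegral_congr fun x => ?_
  rw [← Measure.tsum_indicator_apply_singleton _ _ (measurable_prodMk_left hs), tsum_bool, add_comm]
  rfl

theorem exists_limit {len : ℕ → ℕ} (hlen : Tendsto len atTop atTop)
    {w : (k : ℕ) → Word (len k)} (hw : IsConvergent w) :
    ∃ f : I → I, Measurable f ∧ ConvergesTo w f := by
  obtain ⟨μ, hμ⟩ := exists_clusterPt_of_compactSpace
    (map (fun k => empirical (gridLetters (w k))) atTop)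
  obtain ⟨U, hU, hUμ⟩ := mapClusterPt_iff_ultrafilter.1 hμ
  obtain ⟨f, hf, hlaw⟩ := exists_eq_letterLaw (μ : Measure (I × Bool))
    (map_fst_of_tendsto_gridLetters (hlen.mono_left hU) w hUμ)
  refine ⟨f, hf, fun ℓ u => ?_⟩
  obtain ⟨a, ha⟩ := hw ℓ u
  have h := tendsto_density_of_tendsto_empirical hf.nullMeasurable (hlen.mono_left hU)
    (fun k => (strictMono_gridLetters (w k)).injective) hlaw hUμ u
  simp only [readInOrder_gridLetters] at h
  rwa [tendsto_nhds_unique h (ha.mono_left hU)]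

/-! ### Uniqueness of limits -/

/-- As `f^0 + f^1 = 1`, summing over all but the last letter leaves the factor of the last letter. -/
lemma sum_prod_letterFun_snoc (f : I → I) {k : ℕ} (x : Fin (k + 1) → I) :
    ∑ v : Word k, ∏ i, letterFun f (Fin.snoc (α := fun _ => Bool) v true i) (x i) =
      letterFun f true (x (Fin.last k)) := by
  simp only [Fin.prod_univ_castSucc, Fin.snoc_castSucc, Fin.snoc_last]
  rw [← Finset.sum_mul]
  have h := Finset.prod_univ_sum (fun _ : Fin k => (Finset.univ : Finset Bool))
    fun i b => letterFun f b (x i.castSucc)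
  rw [Fintype.piFinset_univ] at h
  rw [← h]
  simp [letterFun_add]

lemma sum_limitDensity_snoc {f : I → I} (hf : NullMeasurable f volume) (k : ℕ) :
    ∑ v : Word k, limitDensity (Fin.snoc (α := fun _ => Bool) v true : Word (k + 1)) f =
      ((k + 1).factorial : ℝ) * ∫ x in {x : Fin (k + 1) → I | StrictMono x},
        letterFun f true (x (Fin.last k)) := by
  simp only [limitDensity]
  rw [← Finset.mul_sum, ← integral_finsetSum]
  · simp only [sum_prod_letterFun_snoc]
  · intro v _
    refine Integrable.of_bound (C := 1) (AEStronglyMeasurable.restrict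
      (Finset.aemeasurable_fun_prod _ fun j _ => (aemeasurable_letterFun hf
        _).comp_quasiMeasurePreserving (Measure.quasiMeasurePreserving_eval
          (fun _ : Fin (k + 1) => (volume : Measure I)) j)).aestronglyMeasurable)
      (ae_of_all _ fun x => ?_)
    rw [Real.norm_of_nonneg (Finset.prod_nonneg fun j _ => letterFun_nonneg ..)]
    exact Finset.prod_le_one (fun j _ => letterFun_nonneg ..) fun j _ => letterFun_le_one ..

lemma strictMono_iff_castSucc_last {k : ℕ} {x : Fin (k + 1) → I} :
    StrictMono x ↔ StrictMono (fun i : Fin k => x i.castSucc) ∧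
      ∀ i : Fin k, x i.castSucc < x (Fin.last k) := by
  refine ⟨fun h => ⟨h.comp Fin.strictMono_castSucc, fun i => h i.castSucc_lt_last⟩, fun h i j => ?_⟩
  induction j using Fin.lastCases with
  | last =>
    induction i using Fin.lastCases with
    | last => simp
    | cast i => exact fun _ => h.2 i
  | cast j =>
    induction i using Fin.lastCases with
    | last => exact fun hij => absurd hij (Fin.castSucc_lt_last j).not_gt
    | cast i => exact fun hij => h.1 hij

/-- The points of the open simplex `x_1 < ... < x_k` all of whose coordinates are below `t`. -/
def simplexBelow (k : ℕ) (t : I) : Set (Fin k → I) := {y | StrictMono y ∧ ∀ i, y i < t}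

/-- Integration over the simplex of a function of the largest coordinate, by Fubini. -/
lemma setLIntegral_strictMono_last {F : I → ℝ≥0∞} (hF : AEMeasurable F volume) (k : ℕ) :
    ∫⁻ x in {x : Fin (k + 1) → I | StrictMono x}, F (x (Fin.last k)) =
      ∫⁻ t, F t * volume (simplexBelow k t) := by
  let A : Set (I × (Fin k → I)) := {p | StrictMono p.2 ∧ ∀ i, p.2 i < p.1}
  have hA : MeasurableSet A := by
    have : A = Prod.snd ⁻¹' {x | StrictMono x} ∩ ⋂ i, {p | p.2 i < p.1} := by
      ext p; simp [A]
    rw [this]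
    exact (measurable_snd (isOpen_strictMono k).measurableSet).inter
      (MeasurableSet.iInter fun i => measurableSet_lt (by fun_prop) (by fun_prop))
  have hmp := volume_preserving_piFinSuccAbove (fun _ : Fin (k + 1) => I) (Fin.last k)
  have hF1 : AEMeasurable (fun p : I × (Fin k → I) => F p.1) (volume.prod volume) :=
    hF.comp_quasiMeasurePreserving Measure.quasiMeasurePreserving_fst
  rw [← lintegral_indicator (isOpen_strictMono _).measurableSet]
  calc _ = ∫⁻ x, A.indicator (fun p => F p.1)
        (MeasurableEquiv.piFinSuccAbove (fun _ => I) (Fin.last k) x) := by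
        refine lintegral_congr fun x => ?_
        simp only [Set.indicator]
        congr 1
        simp only [A, strictMono_iff_castSucc_last]
        simp [Fin.init_def]
    _ = ∫⁻ p, A.indicator (fun p => F p.1) p ∂(volume.prod volume) :=
        hmp.lintegral_comp_emb (MeasurableEquiv.measurableEmbedding _) _
    _ = _ := by
        rw [lintegral_prod _ (hF1.indicator hA)]
        refine lintegral_congr fun t => ?_
        have hs : MeasurableSet (simplexBelow k t) := measurable_prodMk_left hA
        rw [← lintegral_indicator_const hs]
        rfl

lemma setLIntegral_Iio_pow (k : ℕ) (t : I) :
    ∫⁻ s in Set.Iio t, ENNReal.ofReal ((s : ℝ) ^ k / k.factorial) =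
      ENNReal.ofReal ((t : ℝ) ^ (k + 1) / (k + 1).factorial) := by
  rw [← ofReal_integral_eq_lintegral_ofReal]
  · congr 1
    have h := unitInterval.measurePreserving_coe.setIntegral_preimage_emb
      unitInterval.measurableEmbedding_coe (fun s : ℝ => s ^ k / k.factorial) (Set.Iio (t : ℝ))
    have hset : Set.Iio (t : ℝ) ∩ I = Set.Ico 0 (t : ℝ) := by
      ext s
      simp only [Set.mem_inter_iff, Set.mem_Iio, Set.mem_Icc, Set.mem_Ico]
      exact ⟨fun h => ⟨h.2.1, h.1⟩, fun h => ⟨h.2, h.1, h.2.le.trans t.2.2⟩⟩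
    rw [Measure.restrict_restrict measurableSet_Iio, hset, integral_Ico_eq_integral_Ioc,
      ← intervalIntegral.integral_of_le t.2.1, intervalIntegral.integral_div, integral_pow] at h
    refine h.trans ?_
    rw [Nat.factorial_succ]
    push_cast
    have : (k.factorial : ℝ) ≠ 0 := by positivity
    field_simp
    simp
  · exact Integrable.restrict (Continuous.integrable_of_hasCompactSupport (by fun_prop)
      (HasCompactSupport.of_compactSpace _))
  · exact ae_of_all _ fun s => by have := s.2.1; positivity

/-- The volume of the simplex below `t` is `t ^ k / k!`. -/
lemma volume_simplexBelow (k : ℕ) (t : I) :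
    volume (simplexBelow k t) = ENNReal.ofReal ((t : ℝ) ^ k / k.factorial) := by
  induction k generalizing t with
  | zero =>
    have : simplexBelow 0 t = Set.univ := Set.eq_univ_of_forall fun y =>
      ⟨Subsingleton.strictMono y, fun i => i.elim0⟩
    simp [this]
  | succ k ih =>
    -- The simplex below `t` is cut out of the full simplex by a condition on the largest coordinate.
    have h := setLIntegral_strictMono_last
      (F := (Set.Iio t).indicator 1) ((measurable_one.indicator measurableSet_Iio).aemeasurable) k
    have hset : simplexBelow (k + 1) t =
        {x | x (Fin.last k) ∈ Set.Iio t} ∩ {x | StrictMono x} := by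
      ext x
      refine ⟨fun hx => ⟨hx.2 _, hx.1⟩, fun hx => ⟨hx.2, fun i => ?_⟩⟩
      exact (hx.2.monotone (Fin.le_last i)).trans_lt hx.1
    have hm : MeasurableSet {x : Fin (k + 1) → I | x (Fin.last k) ∈ Set.Iio t} :=
      measurable_pi_apply _ measurableSet_Iio
    rw [hset, ← Measure.restrict_apply hm, ← lintegral_indicator_one hm, ← setLIntegral_Iio_pow,
      ← lintegral_indicator measurableSet_Iio]
    refine h.trans (lintegral_congr fun s => ?_)
    by_cases hs : s ∈ Set.Iio t <;> simp [hs, ih]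

/-- Finite measures on `[0,1]` are determined by their moments. -/
lemma measure_ext_of_moments {μ ν : Measure I} [IsFiniteMeasure μ] [IsFiniteMeasure ν]
    (h : ∀ k : ℕ, ∫ t, (t : ℝ) ^ k ∂μ = ∫ t, (t : ℝ) ^ k ∂ν) : μ = ν := by
  have hint : ∀ (ρ : Measure I) [IsFiniteMeasure ρ] (φ : C(I, ℝ)), Integrable φ ρ := fun ρ _ φ =>
    Continuous.integrable_of_hasCompactSupport φ.continuous (HasCompactSupport.of_compactSpace _)
  have hcont : ∀ (ρ : Measure I) [IsFiniteMeasure ρ],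
      Continuous fun φ : C(I, ℝ) => ∫ t, φ t ∂ρ := fun ρ _ =>
    (LipschitzWith.of_dist_le_mul (K := ⟨ρ.real Set.univ, measureReal_nonneg⟩)
      (dist_integral_continuousMap_le ρ)).continuous
  have hclosed : IsClosed {φ : C(I, ℝ) | ∫ t, φ t ∂μ = ∫ t, φ t ∂ν} :=
    isClosed_eq (hcont μ) (hcont ν)
  have hpoly : (polynomialFunctions I : Set C(I, ℝ)) ⊆
      {φ : C(I, ℝ) | ∫ t, φ t ∂μ = ∫ t, φ t ∂ν} := by
    rintro _ ⟨p, -, rfl⟩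
    have hsum : ∀ (ρ : Measure I) [IsFiniteMeasure ρ],
        ∫ t : I, p.eval (t : ℝ) ∂ρ = ∑ i ∈ Finset.range (p.natDegree + 1),
          p.coeff i * ∫ t : I, (t : ℝ) ^ i ∂ρ := by
      intro ρ _
      simp only [Polynomial.eval_eq_sum_range]
      rw [integral_finsetSum _ fun i _ => hint ρ ⟨fun t : I => p.coeff i * (t : ℝ) ^ i, by fun_prop⟩]
      simp only [integral_const_mul]
    have := (hsum μ).trans ((Finset.sum_congr rfl fun i _ => by rw [h i]).trans (hsum ν).symm)
    simpa using! this
  have hall : ∀ φ : C(I, ℝ), ∫ t, φ t ∂μ = ∫ t, φ t ∂ν := fun φ => by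
    have hφ : φ ∈ (polynomialFunctions I).topologicalClosure := by
      rw [polynomialFunctions_closure_eq_top']; trivial
    exact closure_minimal hpoly hclosed hφ
  exact ext_of_forall_integral_eq_of_IsFiniteMeasure fun φ => hall φ.toContinuousMap

/-- The moments of the measure with density `f` are determined by the densities `t(u, f)`. -/
lemma lintegral_letterFun_pow {f : I → I} (hf : NullMeasurable f volume) (k : ℕ) :
    ∫⁻ t, ENNReal.ofReal (letterFun f true t) * ENNReal.ofReal ((t : ℝ) ^ k / k.factorial) =
      ENNReal.ofReal (((k + 1).factorial : ℝ)⁻¹ *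
        ∑ v : Word k, limitDensity (Fin.snoc (α := fun _ => Bool) v true : Word (k + 1)) f) := by
  have hlast := (aemeasurable_letterFun hf true).comp_quasiMeasurePreserving
        (Measure.quasiMeasurePreserving_eval (fun _ : Fin (k + 1) => (volume : Measure I))
          (Fin.last k))
  rw [sum_limitDensity_snoc hf, inv_mul_cancel_left₀ (by positivity),
    ofReal_integral_eq_lintegral_ofReal]
  · rw [setLIntegral_strictMono_last (F := fun t => ENNReal.ofReal (letterFun f true t))
      (aemeasurable_letterFun hf true).ennreal_ofReal]
    simp only [volume_simplexBelow]
  · refine Integrable.of_bound (C := 1) (AEMeasurable.aestronglyMeasurable hlast).restrict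
      (ae_of_all _ fun x => ?_)
    rw [Real.norm_of_nonneg (letterFun_nonneg ..)]
    exact letterFun_le_one ..
  · exact ae_of_all _ fun x => letterFun_nonneg ..

/-- A function is determined almost everywhere by its subsequence densities. -/
theorem ae_eq_of_limitDensity_eq {f g : I → I} (hf : NullMeasurable f volume)
    (hg : NullMeasurable g volume)
    (h : ∀ (ℓ : ℕ) (u : Word ℓ), limitDensity u f = limitDensity u g) : f =ᵐ[volume] g := by
  have hfin : ∀ {f : I → I}, NullMeasurable f volume → IsFiniteMeasure
      ((volume : Measure I).withDensity fun x => ENNReal.ofReal (letterFun f true x)) :=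
    fun hf => isFiniteMeasure_withDensity_ofReal
      (Integrable.of_bound (C := 1) (aemeasurable_letterFun hf _).aestronglyMeasurable
        (ae_of_all _ fun x => by
          rw [Real.norm_of_nonneg (letterFun_nonneg ..)]; exact letterFun_le_one ..)).2
  have := hfin hf
  have := hfin hg
  have hmom : ∀ {f : I → I}, NullMeasurable f volume → ∀ k : ℕ,
      ∫ t : I, (t : ℝ) ^ k / k.factorial
        ∂((volume : Measure I).withDensity fun x => ENNReal.ofReal (letterFun f true x)) =
      (ENNReal.ofReal (((k + 1).factorial : ℝ)⁻¹ * ∑ v : Word k,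
        limitDensity (Fin.snoc (α := fun _ => Bool) v true : Word (k + 1)) f)).toReal := by
    intro f hf k
    rw [← lintegral_letterFun_pow hf, integral_eq_lintegral_of_nonneg_ae
        (ae_of_all _ fun t => by have := t.2.1; positivity)
        (Continuous.aestronglyMeasurable (by fun_prop)),
      lintegral_withDensity_eq_lintegral_mul₀ (aemeasurable_letterFun hf _).ennreal_ofReal
        (by fun_prop)]
    rfl
  have hmeas : ((volume : Measure I).withDensity fun x => ENNReal.ofReal (letterFun f true x)) =
      (volume : Measure I).withDensity fun x => ENNReal.ofReal (letterFun g true x) := by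
    refine measure_ext_of_moments fun k => ?_
    have hk := (hmom hf k).trans ((by simp only [h]) : _ = _) |>.trans (hmom hg k).symm
    rw [integral_div, integral_div] at hk
    exact (div_left_inj' (by positivity)).1 hk
  rw [withDensity_eq_iff_of_sigmaFinite (aemeasurable_letterFun hf _).ennreal_ofReal
    (aemeasurable_letterFun hg _).ennreal_ofReal] at hmeas
  filter_upwards [hmeas] with x hx
  rw [ENNReal.ofReal_eq_ofReal_iff (letterFun_nonneg ..) (letterFun_nonneg ..)] at hx
  exact Subtype.ext (by simpa [letterFun] using hx)

end WordLimits

theorem theorem3 :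
    -- every convergent word sequence with lengths tending to infinity has a unique limit
    (∀ (len : ℕ → ℕ), Tendsto len atTop atTop →
      ∀ w : (k : ℕ) → WordLimits.Word (len k), WordLimits.IsConvergent w →
        ∃ f : I → I, NullMeasurable f volume ∧ WordLimits.ConvergesTo w f ∧
          ∀ g : I → I, NullMeasurable g volume → WordLimits.ConvergesTo w g →
            f =ᵐ[volume] g) ∧
    -- every Lebesgue measurable function is the limit of a word sequence, with words of length `n`
    (∀ f : I → I, NullMeasurable f volume →
      ∃ w : (n : ℕ) → WordLimits.Word n, WordLimits.ConvergesTo (len := fun n => n) w f) ∧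
    -- almost surely, the `f`-random words converge to `f`: the `n`-th word is read off from `n`
    -- independent `f`-random letters, with any joint law between different `n`
    (∀ f : I → I, NullMeasurable f volume →
      ∀ (Ω : Type*) [MeasurableSpace Ω] (P : Measure Ω) [IsProbabilityMeasure P]
        (Z : (n : ℕ) → Fin n → Ω → I × Bool),
        (∀ n i, HasLaw (Z n i) (WordLimits.letterLaw f) P) →
        (∀ n, iIndepFun (Z n) P) →
        ∀ᵐ ω ∂P, WordLimits.ConvergesTo (len := fun n => n)
          (fun n => WordLimits.readInOrder fun i => Z n i ω) f) := by
  refine ⟨fun len hlen w hw => ?_, fun f hf => WordLimits.exists_convergesTo hf,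
    fun f hf Ω _ P _ Z hlaw hind => WordLimits.ae_convergesTo_readInOrder hf hlaw hind⟩
  obtain ⟨f, hf, hwf⟩ := WordLimits.exists_limit hlen hw
  exact ⟨f, hf.nullMeasurable, hwf, fun g hg hwg =>
    WordLimits.ae_eq_of_limitDensity_eq hf.nullMeasurable hg fun ℓ u =>
      tendsto_nhds_unique (hwf ℓ u) (hwg ℓ u)⟩
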